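/- Let $X$ be a countable set, $m:X\to(0,\infty)$ a vertex weight, regarded as the measure $m(A)=\sum_{x\in A}m(x)$ on all subsets of $X$, and let $\mu:X\times X\to[0,\infty)$, $(x,y)\mapsto\mu_{xy}$, be symmetric with $\mu_{xx}=0$ and $\sum_{y\in X}\mu_{xy}<\infty$ for every $x\in X$. Write $x\sim y$ if $\mu_{xy}>0$, and assume that the weighted graph $(X,\mu,m)$ is connected: any two vertices are joined by a finite path $x=x_0\sim x_1\sim\dots\sim x_n=y$. For $f$ in $F(X)=\{f:X\to\mathbb R \mid \sum_{y}\mu_{xy}|f(y)|<\infty \text{ for all } x\in X\}$ put $$\Delta f(x)=\frac1{m(x)}\sum_{y\in X}\mu_{xy}\,(f(x)-f(y)),$$ and call $f:X\to\mathbb R$ superharmonic if $f\in F(X)$ and $\Delta f\ge 0$ on $X$. Let $E(f)=\frac12\sum_{x,y\in X}\mu_{xy}(f(x)-f(y))^2\in[0,\infty]$, let $Q$ be the closure in $L^2(X,m)$ of the restriction of $E$ to the finitely supported functions, and let $L\ge 0$ be the selfadjoint operator on $L^2(X,m)$ associated with $Q$. The semigroup $e^{-tL}$, $t\ge0$, extends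 to bounded functions by monotone limits; in particular $e^{-tL}1(x)=\lim_K e^{-tL}1_K(x)$, the limit being taken along the finite subsets $K$ of $X$ directed by inclusion. The graph is called stochastically complete if $e^{-tL}1=1$ for all $t\ge0$. **Theorem.** If the connected weighted graph $(X,\mu,m)$ is stochastically complete, then every non-negative superharmonic function $u\in L^1(X,m)$ is constant. -/

import Mathlib

open MeasureTheory Filter Topology
open scoped ENNReal

/-- A weighted graph over the discrete measure space `(X, m)`: `m` is a positive vertex weight and
`μ` a symmetric non-negative edge weight with zero diagonal whose vertex sums are finite. -/
structure WeightedGraph (X : Type*) where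
  m : X → ℝ
  m_pos : ∀ x, 0 < m x
  μ : X → X → ℝ
  μ_nonneg : ∀ x y, 0 ≤ μ x y
  μ_symm : ∀ x y, μ x y = μ y x
  μ_diag : ∀ x, μ x x = 0
  μ_summable : ∀ x, Summable (fun y => μ x y)

namespace WeightedGraph

variable {X : Type*} (G : WeightedGraph X)

/-- `x ∼ y`. -/
def Adj (x y : X) : Prop := 0 < G.μ x y

/-- Any two vertices are joined by a finite path `x = x₀ ∼ x₁ ∼ … ∼ xₙ = y`. -/
def IsConnected : Prop := ∀ x y : X, Relation.ReflTransGen G.Adj x y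

/-- The formal domain `F(X)` of the formal Laplacian. -/
def formalDomain : Set (X → ℝ) := {f | ∀ x, Summable (fun y => G.μ x y * |f y|)}

/-- The formal Laplacian `Δ` (with the sign for which it is a positive operator). -/
noncomputable def laplacian (f : X → ℝ) (x : X) : ℝ :=
  (1 / G.m x) * ∑' y, G.μ x y * (f x - f y)

/-- `f ∈ F(X)` and `Δ f ≥ 0`. -/
def IsSuperharmonic (f : X → ℝ) : Prop :=
  f ∈ G.formalDomain ∧ ∀ x, 0 ≤ G.laplacian f x

/-- The energy `E(f) = ½ ∑_{x,y} μ_{xy} (f(x) - f(y))² ∈ [0, ∞]` of an arbitrary function. -/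
noncomputable def energy (f : X → ℝ) : ℝ≥0∞ :=
  2⁻¹ * ∑' p : X × X, ENNReal.ofReal (G.μ p.1 p.2 * (f p.1 - f p.2) ^ 2)

/-- The bilinear form obtained from `E` by polarization (an absolutely convergent sum as soon as
`f` and `g` have finite energy). -/
noncomputable def energyForm (f g : X → ℝ) : ℝ :=
  (1 / 2) * ∑' p : X × X, G.μ p.1 p.2 * ((f p.1 - f p.2) * (g p.1 - g p.2))

variable [MeasurableSpace X]

/-- The measure on `X` with mass `m x` at each vertex `x`. -/
noncomputable def measure : Measure X :=
  Measure.sum fun x => ENNReal.ofReal (G.m x) • Measure.dirac x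

/-- The real Hilbert space `L²(X, m)`. -/
abbrev L2 : Type _ := Lp ℝ 2 G.measure

variable [DiscreteMeasurableSpace X]

theorem measure_singleton (x : X) : G.measure {x} = ENNReal.ofReal (G.m x) := by
  classical
  rw [measure, Measure.sum_apply _ (MeasurableSet.of_discrete)]
  rw [tsum_eq_single x]
  · simp
  · intro y hy
    simp [hy]

theorem memLp_finsupp (φ : X →₀ ℝ) : MemLp φ 2 G.measure := by
  classical
  induction φ using Finsupp.induction_linear with
  | zero => exact MemLp.zero
  | add f g hf hg => rw [Finsupp.coe_add]; exact hf.add hg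
  | single a b =>
    have h : (⇑(Finsupp.single a b) : X → ℝ) = Set.indicator {a} (fun _ => b) := by
      ext x
      by_cases hx : x = a
      · simp [hx]
      · simp [hx]
    rw [h]
    refine memLp_indicator_const 2 MeasurableSet.of_discrete b (Or.inr ?_)
    rw [measure_singleton]
    exact ENNReal.ofReal_ne_top

/-- The inclusion `C_c(X) ⊆ L²(X, m)` of the finitely supported functions. -/
noncomputable def ofFinsupp (φ : X →₀ ℝ) : G.L2 := (G.memLp_finsupp φ).toLp φ

/-- The domain of the closure `Q` of the restriction of `E` to `C_c(X)`: those `f ∈ L²(X, m)` that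
are approximated by finitely supported functions in the form norm `(‖·‖² + E(·))^{1/2}`.
On it, `Q` is `energyForm`. -/
def formDomain : Set G.L2 :=
  {f | ∀ ε : ℝ, 0 < ε → ∃ φ : X →₀ ℝ,
    ‖f - G.ofFinsupp φ‖ < ε ∧ G.energy (fun x => f x - φ x) < ENNReal.ofReal ε}

/-- `u` lies in the domain of the selfadjoint operator `L` on `L²(X, m)` associated with the closed
form `Q`, and `L u = g`: that is, `u ∈ D(Q)` and `Q(u, v) = ⟨g, v⟩` for all `v ∈ D(Q)`. -/
def OperatorEq (u g : G.L2) : Prop :=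
  u ∈ G.formDomain ∧ ∀ v ∈ G.formDomain, G.energyForm u v = inner ℝ g v

section Resolvent

theorem ae_iff_forall {p : X → Prop} : (∀ᵐ x ∂G.measure, p x) ↔ ∀ x, p x := by
  constructor
  · intro h x
    by_contra hx
    have h0 : G.measure {x} ≤ 0 := by
      rw [← ae_iff.mp h]
      exact measure_mono (by intro y hy; simp only [Set.mem_singleton_iff] at hy; subst hy; exact hx)
    rw [measure_singleton] at h0
    exact absurd (G.m_pos x) (not_lt.mpr (ENNReal.ofReal_eq_zero.mp (le_antisymm h0 bot_le)))
  · intro h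
    exact Eventually.of_forall h

theorem coe_sub (f g : G.L2) (x : X) : (f - g : G.L2) x = f x - g x :=
  (G.ae_iff_forall.mp (Lp.coeFn_sub f g)) x

theorem coe_add (f g : G.L2) (x : X) : (f + g : G.L2) x = f x + g x :=
  (G.ae_iff_forall.mp (Lp.coeFn_add f g)) x

theorem coe_smul (c : ℝ) (f : G.L2) (x : X) : (c • f : G.L2) x = c * f x :=
  (G.ae_iff_forall.mp (Lp.coeFn_smul c f)) x

theorem coe_ofFinsupp (φ : X →₀ ℝ) (x : X) : G.ofFinsupp φ x = φ x :=
  (G.ae_iff_forall.mp (MemLp.coeFn_toLp (G.memLp_finsupp φ))) x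

theorem ext_L2 {f g : G.L2} (h : ∀ x, f x = g x) : f = g :=
  Lp.ext (Eventually.of_forall h)

/-- Point evaluation as a continuous functional. -/
theorem continuous_eval (x : X) : Continuous (fun f : G.L2 => f x) := by
  have key : ∀ f : G.L2, inner ℝ (indicatorConstLp 2 (MeasurableSet.of_discrete (s := {x}))
      (by rw [measure_singleton]; exact ENNReal.ofReal_ne_top) (1 : ℝ) : G.L2) f
      = G.m x * f x := by
    intro f
    rw [L2.inner_indicatorConstLp_one]
    rw [integral_singleton, Measure.real, measure_singleton,
      ENNReal.toReal_ofReal (G.m_pos x).le, smul_eq_mul]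
  have : (fun f : G.L2 => f x) = fun f : G.L2 => (G.m x)⁻¹ *
      inner ℝ (indicatorConstLp 2 (MeasurableSet.of_discrete (s := {x}))
      (by rw [measure_singleton]; exact ENNReal.ofReal_ne_top) (1 : ℝ) : G.L2) f := by
    ext f
    rw [key, inv_mul_cancel_left₀ (G.m_pos x).ne']
  rw [this]
  fun_prop


/-- The scaled gradient `(s μ_{xy} / 2)^{1/2} (f(x) - f(y))`. -/
noncomputable def grad (s : ℝ) (f : X → ℝ) (p : X × X) : ℝ :=
  √(s * G.μ p.1 p.2 / 2) * (f p.1 - f p.2)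

theorem grad_mul_grad {s : ℝ} (hs : 0 < s) (f g : X → ℝ) (p : X × X) :
    G.grad s f p * G.grad s g p =
      s * ((1 / 2) * (G.μ p.1 p.2 * ((f p.1 - f p.2) * (g p.1 - g p.2)))) := by
  have h : √(s * G.μ p.1 p.2 / 2) * √(s * G.μ p.1 p.2 / 2) = s * G.μ p.1 p.2 / 2 :=
    Real.mul_self_sqrt (by have := G.μ_nonneg p.1 p.2; positivity)
  unfold grad
  linear_combination ((f p.1 - f p.2) * (g p.1 - g p.2)) * h

theorem mul_energy {s : ℝ} (hs : 0 < s) (f : X → ℝ) :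
    ENNReal.ofReal s * G.energy f = ∑' p, ENNReal.ofReal (G.grad s f p * G.grad s f p) := by
  have h2 : (2⁻¹ : ℝ≥0∞) = ENNReal.ofReal (1 / 2) := by
    rw [one_div, ENNReal.ofReal_inv_of_pos (by norm_num)]
    norm_num
  rw [energy, ← ENNReal.tsum_mul_left, ← ENNReal.tsum_mul_left]
  refine tsum_congr fun p => ?_
  rw [G.grad_mul_grad hs, ENNReal.ofReal_mul hs.le, ENNReal.ofReal_mul (by norm_num : (0 : ℝ) ≤ 1 / 2), h2,
    ← pow_two]

theorem energy_lt_iff {s : ℝ} (hs : 0 < s) (f : X → ℝ) (hf : G.energy f < ∞) :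
    Summable (fun p => G.grad s f p * G.grad s f p) ∧
      ENNReal.ofReal (∑' p, G.grad s f p * G.grad s f p) = ENNReal.ofReal s * G.energy f := by
  have hnn : ∀ p, 0 ≤ G.grad s f p * G.grad s f p := fun p => mul_self_nonneg _
  have hlt : ∑' p, ENNReal.ofReal (G.grad s f p * G.grad s f p) ≠ ∞ := by
    rw [← G.mul_energy hs]
    exact ENNReal.mul_ne_top ENNReal.ofReal_ne_top hf.ne
  have hsum : Summable (fun p => G.grad s f p * G.grad s f p) := by
    refine (ENNReal.summable_toReal hlt).congr fun p => ?_
    rw [ENNReal.toReal_ofReal (hnn p)]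
  exact ⟨hsum, by rw [G.mul_energy hs, ENNReal.ofReal_tsum_of_nonneg hnn hsum]⟩

theorem energy_add_lt {f g : X → ℝ} (hf : G.energy f < ∞) (hg : G.energy g < ∞) :
    G.energy (fun x => f x + g x) < ∞ := by
  have : G.energy (fun x => f x + g x) ≤ 2 * G.energy f + 2 * G.energy g := by
    unfold energy
    rw [mul_left_comm 2, mul_left_comm 2, ← mul_add]
    gcongr
    rw [← ENNReal.tsum_mul_left, ← ENNReal.tsum_mul_left, ← ENNReal.tsum_add]
    refine ENNReal.tsum_le_tsum fun p => ?_
    have h2 : (2 : ℝ≥0∞) = ENNReal.ofReal 2 := by norm_num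
    have hμ := G.μ_nonneg p.1 p.2
    rw [h2, ← ENNReal.ofReal_mul (by norm_num), ← ENNReal.ofReal_mul (by norm_num),
      ← ENNReal.ofReal_add (by positivity) (by positivity)]
    apply ENNReal.ofReal_le_ofReal
    nlinarith [mul_nonneg hμ (sq_nonneg ((f p.1 - f p.2) - (g p.1 - g p.2)))]
  exact this.trans_lt (ENNReal.add_lt_top.mpr
    ⟨ENNReal.mul_lt_top (by norm_num) hf, ENNReal.mul_lt_top (by norm_num) hg⟩)

theorem energy_finsupp_lt (φ : X →₀ ℝ) : G.energy φ < ∞ := by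
  classical
  induction φ using Finsupp.induction_linear with
  | zero => simp [energy]
  | add f g hf hg => exact G.energy_add_lt hf hg
  | single a b =>
    have hfin : ∀ a, ∑' y, ENNReal.ofReal (G.μ a y) < ∞ := fun a => by
      rw [← ENNReal.ofReal_tsum_of_nonneg (G.μ_nonneg a) (G.μ_summable a)]
      exact ENNReal.ofReal_lt_top
    have h1 : ∑' p : X × X, (if p.1 = a then ENNReal.ofReal (G.μ p.1 p.2) else 0) < ∞ := by
      rw [ENNReal.tsum_prod', tsum_eq_single a]
      · simpa using hfin a
      · intro x hx
        simp [hx]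
    have h2 : ∑' p : X × X, (if p.2 = a then ENNReal.ofReal (G.μ p.1 p.2) else 0) < ∞ := by
      rw [ENNReal.tsum_prod', ENNReal.tsum_comm, tsum_eq_single a]
      · simpa [G.μ_symm _ a] using hfin a
      · intro x hx
        simp [hx]
    unfold energy
    refine ENNReal.mul_lt_top (by norm_num) ?_
    have hle : ∑' p : X × X, ENNReal.ofReal
        (G.μ p.1 p.2 * (Finsupp.single a b p.1 - Finsupp.single a b p.2) ^ 2) ≤
        ENNReal.ofReal (b ^ 2) *
          (∑' p : X × X, (if p.1 = a then ENNReal.ofReal (G.μ p.1 p.2) else 0) +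
          ∑' p : X × X, (if p.2 = a then ENNReal.ofReal (G.μ p.1 p.2) else 0)) := by
      rw [← ENNReal.tsum_add, ← ENNReal.tsum_mul_left]
      refine ENNReal.tsum_le_tsum fun p => ?_
      by_cases hp1 : p.1 = a <;> by_cases hp2 : p.2 = a
      · simp [hp1, hp2]
      · simp [hp1, hp2, ← ENNReal.ofReal_mul (sq_nonneg b), mul_comm]
      · simp [hp1, hp2, ← ENNReal.ofReal_mul (sq_nonneg b), mul_comm]
      · simp [Ne.symm hp1, Ne.symm hp2]
    exact hle.trans_lt (ENNReal.mul_lt_top ENNReal.ofReal_lt_top (ENNReal.add_lt_top.mpr ⟨h1, h2⟩))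

theorem memlp_grad {s : ℝ} (hs : 0 < s) (f : X → ℝ) (hf : G.energy f < ∞) :
    Memℓp (E := fun _ : X × X => ℝ) (G.grad s f) 2 := by
  rw [memℓp_gen_iff (by norm_num)]
  refine (G.energy_lt_iff hs f hf).1.congr fun p => ?_
  simp [pow_two]

theorem energy_lt_of_mem {f : G.L2} (hf : f ∈ G.formDomain) : G.energy f < ∞ := by
  obtain ⟨φ, -, h⟩ := hf 1 one_pos
  have := G.energy_add_lt (h.trans ENNReal.ofReal_lt_top) (G.energy_finsupp_lt φ)
  simpa using this

/-- The Hilbert space in which the form norm is the norm of the graph of the gradient. -/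
abbrev Amb : Type _ := WithLp 2 (G.L2 × lp (fun _ : X × X => ℝ) 2)

/-- The graph of the scaled gradient. -/
noncomputable def graphPt {s : ℝ} (hs : 0 < s) (f : G.L2) (hf : G.energy f < ∞) : G.Amb :=
  WithLp.toLp 2 (f, ⟨G.grad s f, G.memlp_grad hs f hf⟩)

theorem ofFinsupp_energy (φ : X →₀ ℝ) : G.energy (G.ofFinsupp φ) < ∞ := by
  have : (G.ofFinsupp φ : X → ℝ) = φ := funext (G.coe_ofFinsupp φ)
  rw [this]
  exact G.energy_finsupp_lt φ

theorem graphPt_sub {s : ℝ} (hs : 0 < s) (f g h : G.L2) (hf : G.energy f < ∞)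
    (hg : G.energy g < ∞) (hh : G.energy h < ∞) (c : ℝ) (e : ∀ x, h x = f x + c * g x) :
    G.graphPt hs h hh = G.graphPt hs f hf + c • G.graphPt hs g hg := by
  refine WithLp.ofLp_injective 2 (Prod.ext ?_ ?_)
  · refine G.ext_L2 fun x => ?_
    change h x = (f + c • g : G.L2) x
    rw [coe_add, coe_smul, e]
  · refine lp.ext (funext fun p => ?_)
    change G.grad s h p = G.grad s f p + c * G.grad s g p
    simp only [grad, e]
    ring

/-- The graph of the scaled gradient on the finitely supported functions. -/
noncomputable def graphSub {s : ℝ} (hs : 0 < s) : Submodule ℝ G.Amb where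
  carrier := {w | ∃ (φ : X →₀ ℝ), w = G.graphPt hs (G.ofFinsupp φ) (G.ofFinsupp_energy φ)}
  zero_mem' := by
    refine ⟨0, ?_⟩
    rw [G.graphPt_sub hs (G.ofFinsupp 0) (G.ofFinsupp 0) (G.ofFinsupp 0) (G.ofFinsupp_energy 0)
      (G.ofFinsupp_energy 0) (G.ofFinsupp_energy 0) (-1) (by simp [coe_ofFinsupp])]
    simp
  add_mem' := by
    rintro _ _ ⟨φ, rfl⟩ ⟨ψ, rfl⟩
    refine ⟨φ + ψ, ?_⟩
    rw [G.graphPt_sub hs (G.ofFinsupp φ) (G.ofFinsupp ψ) (G.ofFinsupp (φ + ψ))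
      (G.ofFinsupp_energy φ) (G.ofFinsupp_energy ψ) _ 1 (by simp [coe_ofFinsupp]), one_smul]
  smul_mem' := by
    rintro c _ ⟨φ, rfl⟩
    refine ⟨c • φ, ?_⟩
    rw [G.graphPt_sub hs (G.ofFinsupp 0) (G.ofFinsupp φ) (G.ofFinsupp (c • φ))
      (G.ofFinsupp_energy 0) (G.ofFinsupp_energy φ) _ c (by simp [coe_ofFinsupp]),
      G.graphPt_sub hs (G.ofFinsupp 0) (G.ofFinsupp 0) (G.ofFinsupp 0) (G.ofFinsupp_energy 0)
      (G.ofFinsupp_energy 0) (G.ofFinsupp_energy 0) (-1) (by simp [coe_ofFinsupp])]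
    simp

theorem norm_graphPt_sub {s : ℝ} (hs : 0 < s) (w : G.Amb) (f : G.L2) (hf : G.energy f < ∞) :
    ‖w - G.graphPt hs f hf‖ ^ 2 = ‖w.fst - f‖ ^ 2
      + ∑' p, (w.snd p - G.grad s f p) * (w.snd p - G.grad s f p) := by
  rw [WithLp.prod_norm_sq_eq_of_L2]
  congr 1
  rw [← real_inner_self_eq_norm_sq, lp.inner_eq_tsum]
  rfl

/-- The closure of the graph of the gradient is the graph of the gradient on the form domain. -/
theorem mem_closure_iff {s : ℝ} (hs : 0 < s) (w : G.Amb) :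
    w ∈ (G.graphSub hs).topologicalClosure ↔
      ∃ (f : G.L2) (hf : f ∈ G.formDomain), w = G.graphPt hs f (G.energy_lt_of_mem hf) := by
  have diff_energy : ∀ (f : G.L2) (φ : X →₀ ℝ), G.energy f < ∞ →
      G.energy (fun x => f x - φ x) < ∞ := by
    intro f φ hf
    have := G.energy_add_lt hf (G.energy_finsupp_lt (-φ))
    simpa [sub_eq_add_neg] using this
  have diff_sum : ∀ (f : G.L2) (φ : X →₀ ℝ),
      ∑' p, (G.grad s f p - G.grad s (G.ofFinsupp φ) p) *
        (G.grad s f p - G.grad s (G.ofFinsupp φ) p) =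
      ∑' p, G.grad s (fun x => f x - φ x) p * G.grad s (fun x => f x - φ x) p := by
    intro f φ
    refine tsum_congr fun p => ?_
    simp only [grad, coe_ofFinsupp]
    ring
  constructor
  · intro hw
    have hgrad : ∀ p, w.snd p = G.grad s w.fst p := by
      intro p
      have hcl : IsClosed {w : G.Amb | w.snd p = G.grad s w.fst p} := by
        have c1 : Continuous fun w : G.Amb => (w.snd p : ℝ) :=
          ((lp.evalCLM ℝ (fun _ : X × X => ℝ) (p := 2) p).continuous).comp
            (WithLp.continuous_snd 2 _ _)
        have c2 : ∀ x, Continuous fun w : G.Amb => (w.fst : X → ℝ) x := fun x =>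
          (G.continuous_eval x).comp (WithLp.continuous_fst 2 _ _)
        refine isClosed_eq c1 ?_
        unfold grad
        exact continuous_const.mul ((c2 p.1).sub (c2 p.2))
      refine closure_minimal ?_ hcl hw
      rintro _ ⟨φ, rfl⟩
      rfl
    have hsum : Summable fun p => w.snd p * w.snd p := by
      have := lp.summable_inner (𝕜 := ℝ) w.snd w.snd
      simpa [pow_two] using this
    have hen : G.energy w.fst < ∞ := by
      have h1 : ENNReal.ofReal s * G.energy w.fst ≠ ∞ := by
        rw [G.mul_energy hs, ← ENNReal.ofReal_tsum_of_nonneg (fun p => mul_self_nonneg _)]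
        · exact ENNReal.ofReal_ne_top
        · exact hsum.congr fun p => by rw [hgrad]
      by_contra h
      rw [not_lt_top_iff.mp h, ENNReal.mul_top (by simpa using hs)] at h1
      exact h1 rfl
    have hmain : ∀ ε : ℝ, 0 < ε → ∃ φ : X →₀ ℝ,
        ‖w.fst - G.ofFinsupp φ‖ < ε ∧
        G.energy (fun x => w.fst x - φ x) < ENNReal.ofReal ε := by
      intro ε hε
      obtain ⟨δ, hδ, hδ1⟩ : ∃ δ : ℝ, 0 < δ ∧ δ ≤ ε ∧ δ ^ 2 ≤ s * ε := by
        refine ⟨min ε √(s * ε), lt_min hε (Real.sqrt_pos.mpr (by positivity)), min_le_left _ _, ?_⟩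
        refine le_of_le_of_eq ?_ (Real.sq_sqrt (mul_pos hs hε).le)
        have : 0 < min ε √(s * ε) := lt_min hε (Real.sqrt_pos.mpr (by positivity))
        exact pow_le_pow_left₀ this.le (min_le_right _ _) 2
      obtain ⟨_, ⟨φ, rfl⟩, hd⟩ := Metric.mem_closure_iff.mp hw δ hδ
      rw [dist_eq_norm] at hd
      have hn := G.norm_graphPt_sub hs w _ (G.ofFinsupp_energy φ)
      simp only [hgrad] at hn
      rw [diff_sum] at hn
      have hT : 0 ≤ ∑' p, G.grad s (fun x => w.fst x - φ x) p * G.grad s (fun x => w.fst x - φ x) p :=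
        tsum_nonneg fun p => mul_self_nonneg _
      have hlt : ‖w - G.graphPt hs (G.ofFinsupp φ) (G.ofFinsupp_energy φ)‖ ^ 2 < δ ^ 2 :=
        pow_lt_pow_left₀ hd (norm_nonneg _) two_ne_zero
      refine ⟨φ, ?_, ?_⟩
      · refine lt_of_lt_of_le (lt_of_pow_lt_pow_left₀ 2 hδ.le ?_) hδ1.1
        linarith
      · have h1 := (G.energy_lt_iff hs _ (diff_energy w.fst φ hen)).2
        have h2 : ENNReal.ofReal s * G.energy (fun x => w.fst x - φ x)
            < ENNReal.ofReal s * ENNReal.ofReal ε := by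
          rw [← h1, ← ENNReal.ofReal_mul hs.le]
          refine (ENNReal.ofReal_lt_ofReal_iff (by positivity)).mpr ?_
          nlinarith [sq_nonneg ‖w.fst - G.ofFinsupp φ‖]
        exact lt_of_mul_lt_mul_left' h2
    refine ⟨w.fst, hmain, ?_⟩
    refine WithLp.ofLp_injective 2 (Prod.ext rfl ?_)
    exact lp.ext (funext hgrad)
  · rintro ⟨f, hf, rfl⟩
    refine Metric.mem_closure_iff.mpr fun ε hε => ?_
    obtain ⟨δ, hδ, hδ1⟩ : ∃ δ : ℝ, 0 < δ ∧ δ ^ 2 + s * δ < ε ^ 2 := by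
      have hq : 0 < ε ^ 2 / (2 * (1 + s)) := by positivity
      refine ⟨min 1 (ε ^ 2 / (2 * (1 + s))), lt_min one_pos hq, ?_⟩
      set d := min 1 (ε ^ 2 / (2 * (1 + s))) with hd
      have h0 : 0 < d := lt_min one_pos hq
      have h1 : d ≤ 1 := min_le_left _ _
      have h2 : d * (2 * (1 + s)) ≤ ε ^ 2 := by
        rw [← le_div_iff₀ (by positivity)]
        exact min_le_right _ _
      nlinarith [mul_pos h0 hs]
    obtain ⟨φ, h1, h2⟩ := hf δ hδ
    refine ⟨_, ⟨φ, rfl⟩, ?_⟩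
    rw [dist_eq_norm]
    refine lt_of_pow_lt_pow_left₀ 2 hε.le ?_
    rw [G.norm_graphPt_sub hs]
    change ‖f - G.ofFinsupp φ‖ ^ 2 + ∑' p, (G.grad s f p - G.grad s (G.ofFinsupp φ) p) *
        (G.grad s f p - G.grad s (G.ofFinsupp φ) p) < ε ^ 2
    rw [diff_sum]
    have h3 := (G.energy_lt_iff hs _ (h2.trans ENNReal.ofReal_lt_top)).2
    have h4 : ∑' p, G.grad s (fun x => f x - φ x) p * G.grad s (fun x => f x - φ x) p
        ≤ s * δ := by
      rw [← ENNReal.ofReal_le_ofReal_iff (by positivity), h3, ENNReal.ofReal_mul hs.le]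
      gcongr
    have h5 := pow_lt_pow_left₀ h1 (norm_nonneg _) two_ne_zero
    linarith

theorem inner_graphPt {s : ℝ} (hs : 0 < s) (f g : G.L2) (hf : G.energy f < ∞)
    (hg : G.energy g < ∞) :
    inner ℝ (G.graphPt hs f hf) (G.graphPt hs g hg) =
      inner ℝ f g + s * G.energyForm f g := by
  rw [WithLp.prod_inner_apply]
  congr 1
  rw [lp.inner_eq_tsum, energyForm, ← tsum_mul_left, ← tsum_mul_left]
  refine tsum_congr fun p => ?_
  rw [← G.grad_mul_grad hs]
  exact mul_comm _ _

/-- `1 + s L` is a bijection from the domain of `L` onto `L²(X, m)`. -/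
theorem existsUnique_resolvent {s : ℝ} (hs : 0 < s) (f : G.L2) :
    ∃! u : G.L2, ∃ g, G.OperatorEq u g ∧ u + s • g = f := by
  have weak : ∀ u g : G.L2, G.OperatorEq u g → u + s • g = f → ∀ (hu : u ∈ G.formDomain)
      (v : G.L2) (hv : v ∈ G.formDomain), inner ℝ (G.graphPt hs u (G.energy_lt_of_mem hu))
        (G.graphPt hs v (G.energy_lt_of_mem hv)) = inner ℝ f v := by
    intro u g hL hf hu v hv
    rw [inner_graphPt, hL.2 v hv, ← hf, inner_add_left, real_inner_smul_left]
  refine existsUnique_of_exists_of_unique ?_ ?_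
  · let V := (G.graphSub hs).topologicalClosure
    have hVc : IsClosed (V : Set G.Amb) := (G.graphSub hs).isClosed_topologicalClosure
    have : CompleteSpace V := hVc.completeSpace_coe
    let z : G.Amb := WithLp.toLp 2 (f, 0)
    obtain ⟨u, hu, hw⟩ := (G.mem_closure_iff hs _).mp (V.starProjection_apply_mem z)
    refine ⟨u, s⁻¹ • (f - u), ⟨hu, fun v hv => ?_⟩, ?_⟩
    · have hmem := (G.mem_closure_iff hs _).mpr ⟨v, hv, rfl⟩
      have horth := V.starProjection_inner_eq_zero z _ hmem
      rw [hw, inner_sub_left, inner_graphPt] at horth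
      have hz : inner ℝ z (G.graphPt hs v (G.energy_lt_of_mem hv)) = inner ℝ f v := by
        rw [WithLp.prod_inner_apply]
        change inner ℝ f v + inner ℝ (0 : lp (fun _ : X × X => ℝ) 2) _ = _
        rw [inner_zero_left, add_zero]
      rw [hz] at horth
      rw [real_inner_smul_left, inner_sub_left, eq_inv_mul_iff_mul_eq₀ hs.ne']
      linarith
    · rw [smul_smul, mul_inv_cancel₀ hs.ne', one_smul, add_sub_cancel]
  · rintro u₁ u₂ ⟨g₁, hL₁, h₁⟩ ⟨g₂, hL₂, h₂⟩
    have hmem := Submodule.sub_mem _ ((G.mem_closure_iff hs _).mpr ⟨u₁, hL₁.1, rfl⟩)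
      ((G.mem_closure_iff hs _).mpr ⟨u₂, hL₂.1, rfl⟩)
    obtain ⟨v, hv, hvw⟩ := (G.mem_closure_iff hs _).mp hmem
    have h0 : inner ℝ (G.graphPt hs u₁ (G.energy_lt_of_mem hL₁.1)
        - G.graphPt hs u₂ (G.energy_lt_of_mem hL₂.1)) (G.graphPt hs v (G.energy_lt_of_mem hv))
        = 0 := by
      rw [inner_sub_left, weak u₁ g₁ hL₁ h₁ hL₁.1 v hv, weak u₂ g₂ hL₂ h₂ hL₂.1 v hv, sub_self]
    rw [← hvw, inner_self_eq_zero, sub_eq_zero] at h0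
    exact congrArg WithLp.fst h0

end Resolvent

/-- The bounded operator `(1 + s L)⁻¹` on `L²(X, m)`, for `s ≥ 0`: for `s > 0` its value at `f` is
the unique `u` in the domain of `L` with `u + s L u = f`. -/
noncomputable def resolvent (s : ℝ) (f : G.L2) : G.L2 :=
  open Classical in
  if hs : 0 < s then (G.existsUnique_resolvent hs f).choose else f

/-- The semigroup `e^{-tL}`, `t ≥ 0`, on `L²(X, m)`, through the exponential formula
`e^{-tL} f = lim_n (1 + (t/n) L)^{-n} f`; the limit exists in `L²(X, m)` for every `f` because `L`
is selfadjoint and non-negative. -/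
noncomputable def heatSemigroup (t : ℝ) (f : G.L2) : G.L2 :=
  limUnder atTop fun n : ℕ => (G.resolvent (t / (n + 1)))^[n + 1] f

/-- `e^{-tL} 1 = 1` for all `t ≥ 0`. The semigroup is extended from `L²(X, m)` to the bounded
functions by monotone limits, so that `(e^{-tL} 1)(x)` is the limit of `(e^{-tL} 1_K)(x)` as the
finite sets `K` increase to `X`. -/
def IsStochasticallyComplete : Prop :=
  ∀ t : ℝ, 0 ≤ t → ∀ x : X,
    Tendsto (fun K : Finset X => G.heatSemigroup t (G.ofFinsupp (∑ y ∈ K, Finsupp.single y 1)) x)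
      atTop (𝓝 1)

end WeightedGraph

/-!
Suppose `u` is not constant. By connectedness some edge `x ∼ y` has `u y < u x`, and the truncation
`v = min u (u x)` is a bounded superharmonic function in `L¹ ∩ L²` that attains its maximum at `x`,
so that `Δ v > 0` there. This contradicts conservation of mass: stochastic completeness and the
symmetry of the semigroup give `∑ m e^{-L} v = ∑ m v`, whereas `e^{-L} v ≤ v` with strict inequality
at `x`.

Everything is read off from the resolvents `R_s = (1 + s L)⁻¹`, since the semigroup is defined
as the limit of `R_{t/n}^n`.

* `exists_tendsto_pow_apply`: this limit exists, for any family of commuting contractions that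
  satisfies the resolvent relations on a dense set. On the domain of `L ^ 2`, passing from `n` to `n l`
  steps costs `O(1/n)` uniformly in `l`; density comes from the symmetry and injectivity of `R_1`
  (`WeightedGraph.dense_domain_sq`).
* `WeightedGraph.resolvent_le`: `f ≤ v` implies `R_s f ≤ v` for superharmonic `v ≥ 0`. Since `v` need
  not have finite energy, the comparison is made on finitely supported approximations `φ` of `R_s f`,
  where Green's formula shows that replacing `φ` by `min φ v` does not increase the distance to
  `R_s f` in the form norm.
* `WeightedGraph.iterate_resolvent_deficit`: the gap between `v` and `R_{t/n}^n v` at `x` is bounded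
  below uniformly in `n`. Moving `R_{t/n}^n` from `1_K` to `v` by symmetry turns this into a gap
  between `⟨e^{-L} 1_K, v⟩` and `⟨1_K, v⟩`, uniform in the finite set `K ∋ x`; by dominated
  convergence the gap persists as `K` increases to `X`, where both sides tend to `∑ m v`
  (`WeightedGraph.IsStochasticallyComplete.tsum_eq_zero`).
-/

/-! ### The exponential formula for a family of commuting contractions -/

section ExponentialFormula

variable {H : Type*} [NormedAddCommGroup H] [NormedSpace ℝ H]

theorem norm_pow_apply_le_of_norm_le_one {A : H →L[ℝ] H} (hA : ‖A‖ ≤ 1) (n : ℕ) (f : H) :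
    ‖(A ^ n) f‖ ≤ ‖f‖ := by
  induction n with
  | zero => simp
  | succ n ih =>
    rw [pow_succ', mul_apply_eq_comp]
    exact (A.le_of_opNorm_le hA _).trans (by rwa [one_mul])

theorem norm_pow_sub_pow_apply_le {A B : H →L[ℝ] H} (hA : ‖A‖ ≤ 1) (hB : ‖B‖ ≤ 1)
    (hAB : Commute A B) (n : ℕ) (f : H) :
    ‖(A ^ n) f - (B ^ n) f‖ ≤ n * ‖A f - B f‖ := by
  induction n with
  | zero => simp
  | succ n ih =>
    have hcomm : (A ^ n) (B f) = B ((A ^ n) f) :=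
      congrArg (fun T : H →L[ℝ] H => T f) (hAB.pow_left n).eq
    have e : (A ^ (n + 1)) f - (B ^ (n + 1)) f
        = (A ^ n) (A f - B f) + B ((A ^ n) f - (B ^ n) f) := by
      rw [pow_succ, pow_succ', mul_apply_eq_comp, mul_apply_eq_comp,
        map_sub, map_sub, hcomm]
      abel
    rw [e]
    refine (norm_add_le _ _).trans ?_
    have h1 := norm_pow_apply_le_of_norm_le_one hA n (A f - B f)
    have h2 := B.le_of_opNorm_le hB ((A ^ n) f - (B ^ n) f)
    rw [Nat.cast_succ]
    linarith

theorem norm_sub_pow_apply_le {A : H →L[ℝ] H} (hA : ‖A‖ ≤ 1) {s : ℝ} (hs : 0 < s) {g k : H}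
    (hg : g - A g = s • A k) (n : ℕ) : ‖g - (A ^ n) g‖ ≤ n * (s * ‖k‖) := by
  induction n with
  | zero => simp
  | succ n ih =>
    have e : g - (A ^ (n + 1)) g = (g - (A ^ n) g) + (A ^ n) (g - A g) := by
      rw [pow_succ, mul_apply_eq_comp, map_sub]
      abel
    rw [e]
    refine (norm_add_le _ _).trans ?_
    have h1 := norm_pow_apply_le_of_norm_le_one hA n (g - A g)
    have h2 := A.le_of_opNorm_le hA k
    rw [one_mul] at h2
    have h3 : ‖g - A g‖ ≤ s * ‖k‖ := by
      rw [hg, norm_smul, Real.norm_of_nonneg hs.le]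
      gcongr
    rw [Nat.cast_succ]
    linarith

/-- First-order Taylor expansion of `n` steps of size `s`: if `g = L f` and `k = L g` in the sense
of the resolvent identities, then `A ^ n f = f - n s g + O((n s)² ‖k‖)`. -/
theorem norm_smul_sub_sub_pow_apply_le {A : H →L[ℝ] H} (hA : ‖A‖ ≤ 1) {s : ℝ} (hs : 0 < s)
    {f g k : H} (hf : f - A f = s • A g) (hg : g - A g = s • A k) (n : ℕ) :
    ‖(n * s) • g - (f - (A ^ n) f)‖ ≤ (n * s) ^ 2 * ‖k‖ := by
  induction n with
  | zero => simp
  | succ n ih =>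
    have e : ((n + 1 : ℕ) * s) • g - (f - (A ^ (n + 1)) f)
        = ((n * s) • g - (f - (A ^ n) f)) + s • (g - (A ^ (n + 1)) g) := by
      have h1 : (A ^ (n + 1)) f = (A ^ n) f - s • (A ^ (n + 1)) g := by
        rw [pow_succ, mul_apply_eq_comp, mul_apply_eq_comp, ← map_smul,
          ← hf, map_sub]
        abel
      rw [h1]
      push_cast
      module
    rw [e]
    refine (norm_add_le _ _).trans ?_
    have h1 := norm_sub_pow_apply_le hA hs hg (n + 1)
    rw [norm_smul, Real.norm_of_nonneg hs.le]
    have h2 := mul_le_mul_of_nonneg_left h1 hs.le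
    rw [Nat.cast_succ] at h2 ⊢
    nlinarith [mul_nonneg (mul_nonneg (Nat.cast_nonneg (α := ℝ) n) (sq_nonneg s)) (norm_nonneg k)]

variable {J : ℝ → H →L[ℝ] H}

/-- Refining the `n` steps of size `t / n` into `n l` steps of size `t / (n l)` changes the
approximation of the semigroup by `O(1 / n)`, uniformly in `l`. -/
theorem norm_pow_sub_pow_mul_apply_le (hJ : ∀ s, ‖J s‖ ≤ 1) (hcomm : ∀ s r, Commute (J s) (J r))
    {f g k : H} (hf : ∀ s, 0 < s → f - J s f = s • J s g)
    (hg : ∀ s, 0 < s → g - J s g = s • J s k) {t : ℝ} (ht : 0 < t) {n l : ℕ} (hn : 0 < n)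
    (hl : 0 < l) :
    ‖(J (t / n) ^ n) f - (J (t / (n * l : ℕ)) ^ (n * l)) f‖ ≤ 2 * t ^ 2 * ‖k‖ / n := by
  have hn' : (0 : ℝ) < n := Nat.cast_pos.mpr hn
  have hl' : (0 : ℝ) < l := Nat.cast_pos.mpr hl
  set h := t / n with hh
  have hh0 : 0 < h := div_pos ht hn'
  have er : t / (n * l : ℕ) = h / l := by
    rw [hh]; push_cast; field_simp
  rw [er, mul_comm n l, pow_mul]
  have hr : 0 < h / l := div_pos hh0 hl'
  have hB : ‖J (h / l) ^ l‖ ≤ 1 :=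
    ContinuousLinearMap.opNorm_le_bound _ zero_le_one fun x => by
      rw [one_mul]; exact norm_pow_apply_le_of_norm_le_one (hJ _) l x
  refine (norm_pow_sub_pow_apply_le (hJ h) hB ((hcomm h (h / l)).pow_right l) n f).trans ?_
  have h1 := norm_smul_sub_sub_pow_apply_le (hJ h) hh0 (hf h hh0) (hg h hh0) 1
  have h2 := norm_smul_sub_sub_pow_apply_le (hJ (h / l)) hr (hf _ hr) (hg _ hr) l
  rw [mul_div_cancel₀ _ hl'.ne'] at h2
  rw [pow_one, Nat.cast_one, one_mul] at h1
  have h3 : ‖J h f - (J (h / l) ^ l) f‖ ≤ 2 * h ^ 2 * ‖k‖ := by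
    have e : J h f - (J (h / l) ^ l) f
        = (h • g - (f - J h f)) - (h • g - (f - (J (h / l) ^ l) f)) := by abel
    rw [e]
    exact (norm_sub_le _ _).trans (by linarith)
  refine (mul_le_mul_of_nonneg_left h3 hn'.le).trans (le_of_eq ?_)
  rw [hh]
  field_simp

/-- The exponential formula: the backward Euler approximations `J (t / n) ^ n f` converge as soon as
the domain of the square of the generator is dense. -/
theorem exists_tendsto_pow_apply [CompleteSpace H] (hJ : ∀ s, ‖J s‖ ≤ 1)
    (hcomm : ∀ s r, Commute (J s) (J r))
    (hdense : Dense {f : H | ∃ g k, (∀ s, 0 < s → f - J s f = s • J s g) ∧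
      ∀ s, 0 < s → g - J s g = s • J s k}) {t : ℝ} (ht : 0 < t) (f : H) :
    ∃ w, Tendsto (fun n : ℕ => (J (t / (n + 1)) ^ (n + 1)) f) atTop (𝓝 w) := by
  refine cauchySeq_tendsto_of_complete (Metric.cauchySeq_iff'.mpr fun ε hε => ?_)
  obtain ⟨f', hd, g, k, hf, hg⟩ := Metric.dense_iff.mp hdense f (ε / 4) (by positivity)
  rw [Metric.mem_ball, dist_eq_norm] at hd
  obtain ⟨N, hN⟩ := exists_nat_gt (8 * (2 * t ^ 2 * ‖k‖) / ε)
  have hC : 0 ≤ 2 * t ^ 2 * ‖k‖ := by positivity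
  have hsmall : ∀ n : ℕ, N ≤ n → 2 * t ^ 2 * ‖k‖ / (n + 1 : ℕ) ≤ ε / 8 := by
    intro n hn
    have hNn : (N : ℝ) ≤ n := Nat.cast_le.mpr hn
    rw [div_lt_iff₀ hε] at hN
    rw [div_le_iff₀ (by positivity)]
    push_cast
    nlinarith
  refine ⟨N, fun n hn => ?_⟩
  -- the step numbers `n + 1` and `N + 1` are compared through their product
  have h1 := norm_pow_sub_pow_mul_apply_le hJ hcomm hf hg ht n.succ_pos N.succ_pos
  have h2 := norm_pow_sub_pow_mul_apply_le hJ hcomm hf hg ht N.succ_pos n.succ_pos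
  rw [mul_comm N.succ] at h2
  have h3 := h1.trans (hsmall n hn)
  have h4 := h2.trans (hsmall N le_rfl)
  have h5 := norm_pow_apply_le_of_norm_le_one (hJ (t / (n + 1 : ℕ))) (n + 1) (f' - f)
  have h6 := norm_pow_apply_le_of_norm_le_one (hJ (t / (N + 1 : ℕ))) (N + 1) (f' - f)
  rw [map_sub] at h5 h6
  rw [dist_eq_norm]
  simp only [Nat.succ_eq_add_one] at h3 h4
  rw [← Nat.cast_succ, ← Nat.cast_succ]
  simp only [Nat.succ_eq_add_one]
  set a := (J (t / (n + 1 : ℕ)) ^ (n + 1)) f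
  set b := (J (t / (N + 1 : ℕ)) ^ (N + 1)) f
  set a' := (J (t / (n + 1 : ℕ)) ^ (n + 1)) f'
  set b' := (J (t / (N + 1 : ℕ)) ^ (N + 1)) f'
  set c := (J (t / ((n + 1) * (N + 1) : ℕ)) ^ ((n + 1) * (N + 1))) f'
  have e : a - b = (a' - c) - (b' - c) - (a' - a) + (b' - b) := by abel
  rw [e]
  have := norm_add_le ((a' - c) - (b' - c) - (a' - a)) (b' - b)
  have := norm_sub_le ((a' - c) - (b' - c)) (a' - a)
  have := norm_sub_le (a' - c) (b' - c)
  linarith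

end ExponentialFormula

namespace WeightedGraph

variable {X : Type*} (G : WeightedGraph X)

/-! ### Superharmonic functions -/

variable {G} in
theorem IsSuperharmonic.summable {f : X → ℝ} (hf : G.IsSuperharmonic f) (x : X) :
    Summable fun y => G.μ x y * (f x - f y) := by
  have h : Summable fun y => G.μ x y * f y :=
    (hf.1 x).of_norm_bounded fun y => by
      rw [norm_mul, Real.norm_of_nonneg (G.μ_nonneg x y), Real.norm_eq_abs]
  simpa only [mul_sub] using ((G.μ_summable x).mul_right (f x)).sub h

variable {G} in
theorem IsSuperharmonic.tsum_nonneg {f : X → ℝ} (hf : G.IsSuperharmonic f) (x : X) :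
    0 ≤ ∑' y, G.μ x y * (f x - f y) := by
  have h := hf.2 x
  rwa [laplacian, mul_nonneg_iff_of_pos_left (one_div_pos.mpr (G.m_pos x))] at h

theorem isSuperharmonic_const (c : ℝ) : G.IsSuperharmonic fun _ => c :=
  ⟨fun x => (G.μ_summable x).mul_right |c|, fun x => by simp [laplacian]⟩

variable {G} in
theorem IsSuperharmonic.min_const {f : X → ℝ} (hf : G.IsSuperharmonic f) (c : ℝ) :
    G.IsSuperharmonic fun x => min (f x) c := by
  have hdom : (fun x => min (f x) c) ∈ G.formalDomain := fun x =>
    ((hf.1 x).add ((G.μ_summable x).mul_right |c|)).of_nonneg_of_le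
      (fun y => mul_nonneg (G.μ_nonneg x y) (abs_nonneg _)) fun y => by
        rw [← mul_add]
        refine mul_le_mul_of_nonneg_left ?_ (G.μ_nonneg x y)
        dsimp only
        rcases min_choice (f y) c with h | h <;> rw [h] <;>
          linarith [abs_nonneg (f y), abs_nonneg c]
  refine ⟨hdom, fun x => mul_nonneg (one_div_pos.mpr (G.m_pos x)).le ?_⟩
  have hs : Summable fun y => G.μ x y * (min (f x) c - min (f y) c) := by
    have h : Summable fun y => G.μ x y * min (f y) c :=
      (hdom x).of_norm_bounded fun y => by
        rw [norm_mul, Real.norm_of_nonneg (G.μ_nonneg x y), Real.norm_eq_abs]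
    simpa only [mul_sub] using ((G.μ_summable x).mul_right (min (f x) c)).sub h
  rcases le_total (f x) c with h | h
  · refine (hf.tsum_nonneg x).trans ((hf.summable x).tsum_le_tsum (fun y => ?_) hs)
    dsimp only
    rw [min_eq_left h]
    exact mul_le_mul_of_nonneg_left (by linarith [min_le_left (f y) c]) (G.μ_nonneg x y)
  · refine _root_.tsum_nonneg fun y => ?_
    dsimp only
    rw [min_eq_right h]
    exact mul_nonneg (G.μ_nonneg x y) (sub_nonneg.mpr (min_le_right _ _))

/-! ### The energy form and Green's formula -/

theorem energyForm_comm (f g : X → ℝ) : G.energyForm f g = G.energyForm g f := by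
  unfold energyForm
  congr 1
  exact tsum_congr fun p => by ring

theorem energyForm_self_nonneg (f : X → ℝ) : 0 ≤ G.energyForm f f :=
  mul_nonneg (by norm_num) (tsum_nonneg fun p => mul_nonneg (G.μ_nonneg _ _) (mul_self_nonneg _))

variable [MeasurableSpace X]

theorem memLp_two_of_bounded {f : X → ℝ} (hf : MemLp f 1 G.measure) {c : ℝ}
    (hc : ∀ x, |f x| ≤ c) : MemLp f 2 G.measure := by
  rw [memLp_two_iff_integrable_sq hf.1]
  refine ((memLp_one_iff_integrable.mp hf).norm.const_mul c).mono' (hf.1.pow 2)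
    (Eventually.of_forall fun x => ?_)
  rw [norm_pow, pow_two]
  exact mul_le_mul_of_nonneg_right (hc x) (norm_nonneg _)

variable [DiscreteMeasurableSpace X]

theorem summable_energyForm {f g : X → ℝ} (hf : G.energy f < ∞) (hg : G.energy g < ∞) :
    Summable fun p : X × X => G.μ p.1 p.2 * ((f p.1 - f p.2) * (g p.1 - g p.2)) := by
  have hf' := (G.energy_lt_iff one_pos f hf).1
  have hg' := (G.energy_lt_iff one_pos g hg).1
  simp only [G.grad_mul_grad one_pos, one_mul] at hf' hg'
  refine (hf'.add hg').of_norm_bounded fun p => ?_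
  rw [norm_mul, Real.norm_of_nonneg (G.μ_nonneg _ _), Real.norm_eq_abs]
  have h : |(f p.1 - f p.2) * (g p.1 - g p.2)|
      ≤ ((f p.1 - f p.2) * (f p.1 - f p.2) + (g p.1 - g p.2) * (g p.1 - g p.2)) / 2 :=
    abs_le.mpr ⟨by nlinarith [sq_nonneg ((f p.1 - f p.2) + (g p.1 - g p.2))],
      by nlinarith [sq_nonneg ((f p.1 - f p.2) - (g p.1 - g p.2))]⟩
  refine (mul_le_mul_of_nonneg_left h (G.μ_nonneg _ _)).trans (le_of_eq ?_)
  ring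

theorem energyForm_add_mul_left {f g h : X → ℝ} (hf : G.energy f < ∞) (hg : G.energy g < ∞)
    (hh : G.energy h < ∞) (c : ℝ) :
    G.energyForm (fun x => f x + c * g x) h = G.energyForm f h + c * G.energyForm g h := by
  have h1 := G.summable_energyForm hf hh
  have h2 := (G.summable_energyForm hg hh).mul_left c
  unfold energyForm
  rw [mul_left_comm c, ← tsum_mul_left (a := c), ← mul_add, ← h1.tsum_add h2]
  congr 1
  exact tsum_congr fun p => by ring

theorem energyForm_single {f : X → ℝ} (hf : G.energy f < ∞) (a : X) (b : ℝ) :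
    G.energyForm f (Finsupp.single a b) = b * ∑' y, G.μ a y * (f a - f y) := by
  classical
  have hsum := G.summable_energyForm hf (G.energy_finsupp_lt (Finsupp.single a 1))
  have hrow : Summable fun y => G.μ a y * (f a - f y) := by
    have := hsum.comp_injective (Prod.mk_right_injective a)
    refine this.congr fun y => ?_
    by_cases hy : y = a
    · simp [hy, G.μ_diag]
    · simp [Finsupp.single_eq_of_ne hy]
  -- the ordered pairs with first entry `a`, and their mirror images, carry the whole sum
  let A : X × X → ℝ := fun p => if p.1 = a then G.μ a p.2 * (f a - f p.2) else 0
  have hA : HasSum A (∑' y, G.μ a y * (f a - f y)) := by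
    rw [← (Prod.mk_right_injective a).hasSum_iff]
    · simpa [A, Function.comp_def] using hrow.hasSum
    · rintro ⟨x, y⟩ hxy
      have : x ≠ a := fun h => hxy ⟨y, by rw [h]⟩
      simp [A, this]
  have hA' := (Equiv.prodComm X X).hasSum_iff.mpr hA
  have e : (fun p : X × X => G.μ p.1 p.2 * ((f p.1 - f p.2) *
      (Finsupp.single a b p.1 - Finsupp.single a b p.2))) =
      fun p => b * (A p + (A ∘ Equiv.prodComm X X) p) := by
    funext ⟨x, y⟩
    by_cases hx : x = a <;> by_cases hy : y = a
    · simp [A, hx, hy, G.μ_diag]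
    · simp [A, hx, hy]; ring
    · simp [A, hx, hy, G.μ_symm x a]; ring
    · simp [A, hx, hy]
  rw [energyForm, e, ((hA.add hA').mul_left b).tsum_eq]
  ring

/-- Green's formula for a finitely supported test function. -/
theorem energyForm_finsupp {f : X → ℝ} (hf : G.energy f < ∞) (φ : X →₀ ℝ) :
    G.energyForm f φ = φ.sum fun x b => b * ∑' y, G.μ x y * (f x - f y) := by
  induction φ using Finsupp.induction_linear with
  | zero => simp [energyForm]
  | add φ ψ h1 h2 =>
    rw [Finsupp.sum_add_index' (by simp) (by intros; ring), ← h1, ← h2, G.energyForm_comm f φ,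
      G.energyForm_comm f ψ, G.energyForm_comm]
    have := G.energyForm_add_mul_left (G.energy_finsupp_lt φ) (G.energy_finsupp_lt ψ) hf 1
    simp only [one_mul] at this
    exact this
  | single a b => rw [G.energyForm_single hf, Finsupp.sum_single_index (by simp)]

/-! ### Sums over the vertices -/

theorem hasSum_integral {f : X → ℝ} (hf : Integrable f G.measure) :
    HasSum (fun x => G.m x * f x) (∫ x, f x ∂G.measure) := by
  have h := hasSum_integral_measure (μ := fun x => ENNReal.ofReal (G.m x) • Measure.dirac x) hf
  simp only [integral_smul_measure, integral_dirac, ENNReal.toReal_ofReal (G.m_pos _).le,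
    smul_eq_mul] at h
  exact h

theorem summable_of_memLp_one {f : X → ℝ} (hf : MemLp f 1 G.measure) :
    Summable fun x => G.m x * |f x| := by
  simpa using (G.hasSum_integral (memLp_one_iff_integrable.mp hf).norm).summable

theorem hasSum_inner (f g : G.L2) : HasSum (fun x => G.m x * (f x * g x)) (inner ℝ f g) := by
  rw [L2.inner_def]
  simpa [mul_comm] using G.hasSum_integral (L2.integrable_inner (𝕜 := ℝ) f g)

theorem inner_ofFinsupp_single (f : G.L2) (a : X) (b : ℝ) :
    inner ℝ f (G.ofFinsupp (Finsupp.single a b)) = G.m a * (f a * b) := by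
  classical
  refine (G.hasSum_inner _ _).unique ?_
  convert hasSum_single (f := fun x => G.m x * (f x * G.ofFinsupp (Finsupp.single a b) x)) a ?_
    using 1
  · simp [coe_ofFinsupp]
  · intro x hx
    simp [coe_ofFinsupp, Finsupp.single_eq_of_ne hx]

/-! ### The form domain, the operator and its resolvents -/

theorem ofFinsupp_mem_formDomain (φ : X →₀ ℝ) : G.ofFinsupp φ ∈ G.formDomain := fun ε hε =>
  ⟨φ, by simpa using hε, by simpa [energy, coe_ofFinsupp] using hε⟩

theorem add_smul_mem_formDomain {f g : G.L2} (hf : f ∈ G.formDomain) (hg : g ∈ G.formDomain)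
    (c : ℝ) : f + c • g ∈ G.formDomain := by
  have hf' := (G.mem_closure_iff one_pos _).mpr ⟨f, hf, rfl⟩
  have hg' := (G.mem_closure_iff one_pos _).mpr ⟨g, hg, rfl⟩
  obtain ⟨h, hh, e⟩ := (G.mem_closure_iff one_pos _).mp
    (Submodule.add_mem _ hf' (Submodule.smul_mem _ c hg'))
  have : f + c • g = h := congrArg WithLp.fst e
  rwa [this]

variable {G} in
theorem OperatorEq.add_smul {u v f g : G.L2} (hu : G.OperatorEq u f) (hv : G.OperatorEq v g)
    (c : ℝ) : G.OperatorEq (u + c • v) (f + c • g) := by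
  refine ⟨G.add_smul_mem_formDomain hu.1 hv.1 c, fun w hw => ?_⟩
  have e : ((u + c • v : G.L2) : X → ℝ) = fun x => u x + c * v x :=
    funext fun x => by rw [coe_add, coe_smul]
  rw [e, G.energyForm_add_mul_left (G.energy_lt_of_mem hu.1) (G.energy_lt_of_mem hv.1)
    (G.energy_lt_of_mem hw), hu.2 w hw, hv.2 w hw, inner_add_left, real_inner_smul_left]

theorem resolvent_spec {s : ℝ} (hs : 0 < s) (f : G.L2) :
    ∃ g, G.OperatorEq (G.resolvent s f) g ∧ G.resolvent s f + s • g = f := by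
  rw [resolvent, dif_pos hs]
  exact (G.existsUnique_resolvent hs f).choose_spec.1

theorem resolvent_add_smul {s : ℝ} (hs : 0 < s) {u g : G.L2} (h : G.OperatorEq u g) :
    G.resolvent s (u + s • g) = u :=
  (G.existsUnique_resolvent hs (u + s • g)).unique (G.resolvent_spec hs _) ⟨g, h, rfl⟩

theorem resolvent_of_nonpos {s : ℝ} (hs : s ≤ 0) (f : G.L2) : G.resolvent s f = f := by
  rw [resolvent, dif_neg hs.not_gt]

theorem resolvent_add_smul_apply (s : ℝ) (f g : G.L2) (c : ℝ) :
    G.resolvent s (f + c • g) = G.resolvent s f + c • G.resolvent s g := by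
  rcases lt_or_ge 0 s with hs | hs
  · obtain ⟨f', hf, hf'⟩ := G.resolvent_spec hs f
    obtain ⟨g', hg, hg'⟩ := G.resolvent_spec hs g
    rw [← G.resolvent_add_smul hs (hf.add_smul hg c)]
    congr 1
    nth_rw 1 [← hf', ← hg']
    module
  · simp only [G.resolvent_of_nonpos hs]

/-- The weak form of the equation `u + s L u = f`. -/
theorem inner_resolvent_add {s : ℝ} (hs : 0 < s) (f : G.L2) {v : G.L2} (hv : v ∈ G.formDomain) :
    inner ℝ (G.resolvent s f) v + s * G.energyForm (G.resolvent s f) v = inner ℝ f v := by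
  obtain ⟨g, hg, h⟩ := G.resolvent_spec hs f
  rw [hg.2 v hv, ← real_inner_smul_left, ← inner_add_left, h]

theorem resolvent_mem_formDomain {s : ℝ} (hs : 0 < s) (f : G.L2) :
    G.resolvent s f ∈ G.formDomain := by
  obtain ⟨g, hg, -⟩ := G.resolvent_spec hs f
  exact hg.1

theorem norm_resolvent_le (s : ℝ) (f : G.L2) : ‖G.resolvent s f‖ ≤ ‖f‖ := by
  rcases lt_or_ge 0 s with hs | hs
  · have h := G.inner_resolvent_add hs f (G.resolvent_mem_formDomain hs f)
    have h1 := mul_nonneg hs.le (G.energyForm_self_nonneg (G.resolvent s f))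
    have h2 := real_inner_le_norm f (G.resolvent s f)
    rw [real_inner_self_eq_norm_mul_norm] at h
    by_contra! hlt
    nlinarith [norm_nonneg f, norm_nonneg (G.resolvent s f)]
  · rw [G.resolvent_of_nonpos hs]

theorem inner_resolvent_left (s : ℝ) (f g : G.L2) :
    inner ℝ (G.resolvent s f) g = inner ℝ f (G.resolvent s g) := by
  rcases lt_or_ge 0 s with hs | hs
  · rw [← G.inner_resolvent_add hs f (G.resolvent_mem_formDomain hs g), real_inner_comm,
      ← G.inner_resolvent_add hs g (G.resolvent_mem_formDomain hs f), real_inner_comm,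
      energyForm_comm]
  · simp only [G.resolvent_of_nonpos hs]

theorem resolvent_comm (s r : ℝ) (f : G.L2) :
    G.resolvent s (G.resolvent r f) = G.resolvent r (G.resolvent s f) := by
  rcases lt_or_ge 0 s with hs | hs
  · rcases lt_or_ge 0 r with hr | hr
    · obtain ⟨a, ha, ha'⟩ := G.resolvent_spec hr f
      obtain ⟨b, hb, hb'⟩ := G.resolvent_spec hs (G.resolvent r f)
      set w := G.resolvent r f
      set p := G.resolvent s w
      -- `q = p + r L p` solves `q + s L q = f`, because `L p = s⁻¹ (w - p)` is again in the domain
      have hbL : G.OperatorEq b (s⁻¹ • (a - b)) := by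
        have h := ((ha.add_smul hb (-1)).add_smul (ha.add_smul hb (-1)) (s⁻¹ - 1))
        convert h using 1
        · rw [← hb']
          match_scalars <;> field_simp <;> ring
        · module
      have hq := G.resolvent_add_smul hs (hb.add_smul hbL r)
      have e : p + r • b + s • (b + r • s⁻¹ • (a - b)) = f := by
        rw [← ha', ← hb']
        match_scalars <;> field_simp
        ring
      rw [e] at hq
      rw [hq, G.resolvent_add_smul hr hb]
    · simp only [G.resolvent_of_nonpos hr]
  · simp only [G.resolvent_of_nonpos hs]

/-- The resolvent `(1 + s L)⁻¹` as a bounded linear operator. -/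
noncomputable def resolventCLM (s : ℝ) : G.L2 →L[ℝ] G.L2 :=
  LinearMap.mkContinuous
    { toFun := G.resolvent s
      map_add' := fun f g => by simpa using G.resolvent_add_smul_apply s f g 1
      map_smul' := fun c f => by
        have h0 : G.resolvent s 0 = 0 := norm_le_zero_iff.mp (by
          simpa using G.norm_resolvent_le s 0)
        simpa [h0] using G.resolvent_add_smul_apply s 0 f c }
    1 fun f => by rw [one_mul]; exact G.norm_resolvent_le s f

theorem coe_resolventCLM (s : ℝ) : ⇑(G.resolventCLM s) = G.resolvent s := rfl

theorem norm_resolventCLM_le (s : ℝ) : ‖G.resolventCLM s‖ ≤ 1 :=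
  LinearMap.mkContinuous_norm_le _ zero_le_one _

theorem resolventCLM_commute (s r : ℝ) : Commute (G.resolventCLM s) (G.resolventCLM r) :=
  ContinuousLinearMap.ext fun f => G.resolvent_comm s r f

variable {G} in
theorem OperatorEq.sub_resolventCLM {f g : G.L2} (h : G.OperatorEq f g) {s : ℝ} (hs : 0 < s) :
    f - G.resolventCLM s f = s • G.resolventCLM s g := by
  have e := G.resolvent_add_smul hs h
  rw [← coe_resolventCLM, map_add, map_smul] at e
  nth_rw 1 [← e]
  abel

theorem resolvent_eq_zero {s : ℝ} (hs : 0 < s) {f : G.L2} (h : G.resolvent s f = 0) : f = 0 := by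
  refine G.ext_L2 fun x => ?_
  have h1 := G.inner_resolvent_add hs f (G.ofFinsupp_mem_formDomain (Finsupp.single x 1))
  have e : ((0 : G.L2) : X → ℝ) = fun _ => 0 := funext (G.ae_iff_forall.mp (Lp.coeFn_zero _ _ _))
  rw [h, inner_zero_left, inner_ofFinsupp_single, e] at h1
  rw [e]
  simpa [energyForm, (G.m_pos x).ne'] using h1.symm

/-- The domain of the square of `L` is dense, because it is the range of the square of the symmetric injective
operator `(1 + L)⁻¹`. -/
theorem dense_domain_sq :
    Dense {f : G.L2 | ∃ g k, (∀ s, 0 < s → f - G.resolventCLM s f = s • G.resolventCLM s g) ∧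
      ∀ s, 0 < s → g - G.resolventCLM s g = s • G.resolventCLM s k} := by
  have hrange : Dense ((LinearMap.range (G.resolventCLM 1 ^ 2).toLinearMap : Submodule ℝ G.L2) :
      Set G.L2) := by
    rw [Submodule.dense_iff_topologicalClosure_eq_top, Submodule.topologicalClosure_eq_top_iff,
      Submodule.eq_bot_iff]
    intro h hh
    have h0 : G.resolvent 1 (G.resolvent 1 h) = 0 := by
      rw [← inner_self_eq_zero (𝕜 := ℝ), ← G.inner_resolvent_left, ← G.inner_resolvent_left,
        real_inner_comm]
      rw [Submodule.mem_orthogonal] at hh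
      rw [real_inner_comm]
      exact hh _ ⟨_, rfl⟩
    exact G.resolvent_eq_zero one_pos (G.resolvent_eq_zero one_pos h0)
  refine hrange.mono ?_
  rintro _ ⟨h, rfl⟩
  obtain ⟨a, ha, -⟩ := G.resolvent_spec one_pos h
  obtain ⟨b, hb, hb'⟩ := G.resolvent_spec one_pos (G.resolvent 1 h)
  have hbL : G.OperatorEq b (a + (-1 : ℝ) • b) := by
    have e : b = G.resolvent 1 h + (-1 : ℝ) • G.resolvent 1 (G.resolvent 1 h) := by
      rw [one_smul] at hb'
      rw [neg_one_smul, ← sub_eq_add_neg, eq_sub_iff_add_eq', hb']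
    have h := ha.add_smul hb (-1)
    rwa [← e] at h
  exact ⟨b, _, fun s hs => hb.sub_resolventCLM hs, fun s hs => hbL.sub_resolventCLM hs⟩

/-- The exponential formula: the limit that defines `heatSemigroup` exists. -/
theorem tendsto_heatSemigroup {t : ℝ} (ht : 0 < t) (f : G.L2) :
    Tendsto (fun n : ℕ => (G.resolvent (t / (n + 1)))^[n + 1] f) atTop
      (𝓝 (G.heatSemigroup t f)) := by
  refine tendsto_nhds_limUnder ?_
  simpa only [FunLike.coe_pow_eq_iterate, coe_resolventCLM] using
    exists_tendsto_pow_apply G.norm_resolventCLM_le G.resolventCLM_commute G.dense_domain_sq ht f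

theorem inner_iterate_resolvent_left (s : ℝ) (n : ℕ) (f g : G.L2) :
    inner ℝ ((G.resolvent s)^[n] f) g = inner ℝ f ((G.resolvent s)^[n] g) := by
  induction n generalizing f with
  | zero => rfl
  | succ n ih =>
    rw [Function.iterate_succ_apply, ih, inner_resolvent_left, Function.iterate_succ_apply' _ n g]

/-! ### Superharmonic functions dominate the resolvents -/

theorem isClosed_setOf_le (v : X → ℝ) : IsClosed {f : G.L2 | ∀ x, f x ≤ v x} := by
  simp only [Set.ofPred_forall]
  exact isClosed_iInter fun x => isClosed_le (G.continuous_eval x) continuous_const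

/-- Cutting a finitely supported function `φ` at a superharmonic function `v ≥ 0` removes a part
which has non-negative energy product with the rest. -/
theorem energyForm_min_nonneg {v : X → ℝ} (hv : G.IsSuperharmonic v) {χ ψ : X →₀ ℝ}
    (hχ : ∀ x, χ x ≤ v x) (hψ : ∀ x, 0 ≤ ψ x) (hχψ : ∀ x, ψ x ≠ 0 → χ x = v x) :
    0 ≤ G.energyForm χ ψ := by
  rw [G.energyForm_finsupp (G.energy_finsupp_lt χ)]
  refine Finset.sum_nonneg fun x hx => mul_nonneg (hψ x) ?_
  have hχs : Summable fun y => G.μ x y * (χ x - χ y) := by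
    have h : Summable fun y => G.μ x y * χ y :=
      summable_of_hasFiniteSupport (χ.hasFiniteSupport.subset fun y hy => right_ne_zero_of_mul hy)
    simpa only [mul_sub] using ((G.μ_summable x).mul_right (χ x)).sub h
  refine (hv.tsum_nonneg x).trans ((hv.summable x).tsum_le_tsum (fun y => ?_) hχs)
  rw [hχψ x (Finsupp.mem_support_iff.mp hx)]
  exact mul_le_mul_of_nonneg_left (by linarith [hχ y]) (G.μ_nonneg x y)

theorem norm_sub_le_of_inner_nonneg {H : Type*} [NormedAddCommGroup H] [InnerProductSpace ℝ H]
    {a b p : H} (h : 0 ≤ inner ℝ (b - a) p) : ‖b - a‖ ≤ ‖b + p - a‖ := by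
  have e : b + p - a = (b - a) + p := by abel
  have h1 := norm_add_sq_real (b - a) p
  rw [e]
  exact le_of_sq_le_sq (by nlinarith [sq_nonneg ‖p‖]) (norm_nonneg _)

/-- The minimum principle: the solution of `w + s L w = f` lies below every superharmonic `v ≥ 0`
with `f ≤ v`. In the form norm, finitely supported approximations `φ` of `w` do not get worse when
they are replaced by `min φ v`. -/
theorem resolvent_le {v : X → ℝ} (hv : G.IsSuperharmonic v) (hv0 : ∀ x, 0 ≤ v x) (s : ℝ)
    {f : G.L2} (hf : ∀ x, f x ≤ v x) (x : X) : G.resolvent s f x ≤ v x := by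
  rcases lt_or_ge 0 s with hs | hs
  swap
  · rw [G.resolvent_of_nonpos hs]
    exact hf x
  suffices h : G.resolvent s f ∈ closure {g : G.L2 | ∀ x, g x ≤ v x} by
    rw [(G.isClosed_setOf_le v).closure_eq] at h
    exact h x
  have hw := G.resolvent_mem_formDomain hs f
  refine Metric.mem_closure_iff.mpr fun ε hε => ?_
  obtain ⟨_, ⟨φ, rfl⟩, hd⟩ := Metric.mem_closure_iff.mp
    ((G.mem_closure_iff hs _).mpr ⟨_, hw, rfl⟩) ε hε
  let ψ : X →₀ ℝ := Finsupp.onFinset φ.support (fun x => max (φ x - v x) 0) fun x hx => by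
    rw [Finsupp.mem_support_iff]
    intro h0
    exact hx (by rw [h0]; exact max_eq_right (by linarith [hv0 x]))
  let χ : X →₀ ℝ := φ - ψ
  have hψ : ∀ x, ψ x = max (φ x - v x) 0 := fun x => rfl
  have hχ : ∀ x, χ x = φ x - max (φ x - v x) 0 := fun x => rfl
  have hχv : ∀ x, χ x ≤ v x := fun x => by
    rw [hχ]; linarith [le_max_left (φ x - v x) 0]
  have hψ0 : ∀ x, 0 ≤ ψ x := fun x => le_max_right _ _
  have hχψ : ∀ x, ψ x ≠ 0 → χ x = v x := fun x hx => by
    rw [hψ] at hx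
    rcases max_choice (φ x - v x) 0 with h | h
    · rw [hχ, h]; ring
    · exact absurd h hx
  have hE := G.energyForm_min_nonneg hv hχv hψ0 hχψ
  have hadd := G.graphPt_sub hs (G.ofFinsupp χ) (G.ofFinsupp ψ) (G.ofFinsupp φ)
    (G.ofFinsupp_energy χ) (G.ofFinsupp_energy ψ) (G.ofFinsupp_energy φ) 1
    (fun x => by simp only [coe_ofFinsupp, hχ, hψ]; ring)
  rw [one_smul] at hadd
  have hpos : 0 ≤ inner ℝ (G.graphPt hs (G.ofFinsupp χ) (G.ofFinsupp_energy χ)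
      - G.graphPt hs (G.resolvent s f) (G.energy_lt_of_mem hw))
      (G.graphPt hs (G.ofFinsupp ψ) (G.ofFinsupp_energy ψ)) := by
    rw [inner_sub_left, inner_graphPt, inner_graphPt,
      G.inner_resolvent_add hs f (G.ofFinsupp_mem_formDomain ψ)]
    have hχ' : (G.ofFinsupp χ : X → ℝ) = χ := funext (G.coe_ofFinsupp χ)
    have hψ' : (G.ofFinsupp ψ : X → ℝ) = ψ := funext (G.coe_ofFinsupp ψ)
    have h1 : 0 ≤ inner ℝ (G.ofFinsupp χ) (G.ofFinsupp ψ) - inner ℝ f (G.ofFinsupp ψ) := by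
      rw [sub_nonneg]
      refine hasSum_le (fun x => ?_) (G.hasSum_inner f _) (G.hasSum_inner _ _)
      rw [hχ', hψ']
      refine mul_le_mul_of_nonneg_left ?_ (G.m_pos x).le
      by_cases hx : ψ x = 0
      · rw [hx, mul_zero, mul_zero]
      · rw [hχψ x hx]
        exact mul_le_mul_of_nonneg_right (hf x) (hψ0 x)
    have h2 : 0 ≤ s * G.energyForm (G.ofFinsupp χ) (G.ofFinsupp ψ) := by
      rw [hχ', hψ']
      exact mul_nonneg hs.le hE
    linarith
  refine ⟨G.ofFinsupp χ, fun x => by rw [coe_ofFinsupp]; exact hχv x, ?_⟩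
  have h1 := norm_sub_le_of_inner_nonneg hpos
  rw [← hadd] at h1
  rw [dist_comm, dist_eq_norm] at hd ⊢
  exact ((WithLp.norm_fst_le _ _).trans h1).trans_lt hd

theorem iterate_resolvent_le {v : X → ℝ} (hv : G.IsSuperharmonic v) (hv0 : ∀ x, 0 ≤ v x) (s : ℝ)
    (n : ℕ) {f : G.L2} (hf : ∀ x, f x ≤ v x) (x : X) : (G.resolvent s)^[n] f x ≤ v x := by
  induction n generalizing f with
  | zero => exact hf x
  | succ n ih =>
    rw [Function.iterate_succ_apply]
    exact ih (G.resolvent_le hv hv0 s hf)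

theorem resolvent_nonneg (s : ℝ) {f : G.L2} (hf : ∀ x, 0 ≤ f x) (x : X) :
    0 ≤ G.resolvent s f x := by
  have h := G.resolvent_le (G.isSuperharmonic_const 0) (fun _ => le_rfl) s
    (f := (-1 : ℝ) • f) (fun x => by rw [coe_smul]; linarith [hf x]) x
  rw [← coe_resolventCLM, map_smul, coe_smul, coe_resolventCLM] at h
  linarith

theorem iterate_resolvent_nonneg (s : ℝ) (n : ℕ) {f : G.L2} (hf : ∀ x, 0 ≤ f x) (x : X) :
    0 ≤ (G.resolvent s)^[n] f x := by
  induction n generalizing f with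
  | zero => exact hf x
  | succ _ ih =>
    rw [Function.iterate_succ_apply]
    exact ih (G.resolvent_nonneg s hf)

theorem heatSemigroup_mem_Icc {t : ℝ} (ht : 0 < t) {f : G.L2} (h0 : ∀ x, 0 ≤ f x)
    (h1 : ∀ x, f x ≤ 1) (x : X) : G.heatSemigroup t f x ∈ Set.Icc 0 1 :=
  isClosed_Icc.mem_of_tendsto
    (((G.continuous_eval x).tendsto _).comp (G.tendsto_heatSemigroup ht f))
    (Eventually.of_forall fun _ => ⟨G.iterate_resolvent_nonneg _ _ h0 x,
      G.iterate_resolvent_le (G.isSuperharmonic_const 1) (fun _ => zero_le_one) _ _ h1 x⟩)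

/-! ### The decay of the semigroup on a superharmonic function -/

/-- The equation `u + s L u = f` at a vertex. -/
theorem resolvent_apply {s : ℝ} (hs : 0 < s) (f : G.L2) (x : X) :
    G.m x * G.resolvent s f x
      + s * ∑' y, G.μ x y * (G.resolvent s f x - G.resolvent s f y) = G.m x * f x := by
  have h := G.inner_resolvent_add hs f (G.ofFinsupp_mem_formDomain (Finsupp.single x 1))
  have e : (G.ofFinsupp (Finsupp.single x 1) : X → ℝ) = Finsupp.single x 1 :=
    funext (G.coe_ofFinsupp _)
  rwa [inner_ofFinsupp_single, inner_ofFinsupp_single, e,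
    G.energyForm_single (G.energy_lt_of_mem (G.resolvent_mem_formDomain hs f)), one_mul, mul_one,
    mul_one] at h

theorem summable_mul_sub_of_mem {f : G.L2} (hf : f ∈ G.formDomain) (x : X) :
    Summable fun y => G.μ x y * (f x - f y) := by
  classical
  have hsum := G.summable_energyForm (G.energy_lt_of_mem hf)
    (G.energy_finsupp_lt (Finsupp.single x 1))
  refine (hsum.comp_injective (Prod.mk_right_injective x)).congr fun y => ?_
  by_cases hy : y = x
  · simp [hy, G.μ_diag]
  · simp [Finsupp.single_eq_of_ne hy]

/-- If `Δ v > 0` at `x`, then `n` resolvent steps of size `s` push `v` down at `x` by an amount that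
depends on `n` and `s` only through the total time `n s`. Here `η = m(x) Δ v(x)` and `d` is the
degree of `x`; the deficit `e_k = v - R_s^k v` at `x` obeys
`(m + s d) e_{k+1} ≥ m e_k + s η`. -/
theorem iterate_resolvent_deficit {v : G.L2} (hv : G.IsSuperharmonic v) (hv0 : ∀ x, 0 ≤ v x)
    {s : ℝ} (hs : 0 < s) (x : X) (n : ℕ) :
    (n * s) * (∑' y, G.μ x y * (v x - v y)) / (G.m x + (n * s) * ∑' y, G.μ x y)
      ≤ v x - (G.resolvent s)^[n] v x := by
  have hm := G.m_pos x
  have hd : 0 ≤ ∑' y, G.μ x y := tsum_nonneg (G.μ_nonneg x)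
  have hη := hv.tsum_nonneg x
  set η := ∑' y, G.μ x y * (v x - v y)
  set d := ∑' y, G.μ x y with hd_def
  induction n with
  | zero => simp
  | succ n ih =>
    rw [Function.iterate_succ_apply']
    set w := (G.resolvent s)^[n] v
    have hle : ∀ y, G.resolvent s w y ≤ v y :=
      G.resolvent_le hv hv0 s (G.iterate_resolvent_le hv hv0 s n fun _ => le_rfl)
    have heq := G.resolvent_apply hs w x
    have hsum : η - d * (v x - G.resolvent s w x)
        ≤ ∑' y, G.μ x y * (G.resolvent s w x - G.resolvent s w y) := by
      rw [hd_def, ← tsum_mul_right, ← (hv.summable x).tsum_sub ((G.μ_summable x).mul_right _)]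
      refine Summable.tsum_le_tsum (fun y => ?_)
        ((hv.summable x).sub ((G.μ_summable x).mul_right _))
        (G.summable_mul_sub_of_mem (G.resolvent_mem_formDomain hs w) x)
      rw [← mul_sub]
      exact mul_le_mul_of_nonneg_left (by linarith [hle y]) (G.μ_nonneg x y)
    have hstep : G.m x * (v x - w x) + s * η ≤ (G.m x + s * d) * (v x - G.resolvent s w x) := by
      nlinarith
    have hns : (0 : ℝ) ≤ n * s := by positivity
    push_cast
    set r := (n : ℝ) * s with hr
    have er : ((n : ℝ) + 1) * s = r + s := by rw [hr]; ring
    rw [er]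
    have hstep' : G.m x * (r * η / (G.m x + r * d)) + s * η
        ≤ (G.m x + s * d) * (v x - G.resolvent s w x) :=
      le_trans (by gcongr) hstep
    refine le_of_mul_le_mul_left (le_trans ?_ hstep') (by positivity : 0 < G.m x + s * d)
    rw [← mul_div_assoc, ← mul_div_assoc, div_add' _ _ _ (by positivity : G.m x + r * d ≠ 0),
      div_le_div_iff₀ (by positivity) (by positivity)]
    have : 0 ≤ G.m x * s * r * d * η := by positivity
    have e : (G.m x * (r * η) + s * η * (G.m x + r * d)) * (G.m x + (r + s) * d)
        - (G.m x + s * d) * ((r + s) * η) * (G.m x + r * d) = G.m x * s * r * d * η := by ring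
    linarith

/-- In a stochastically complete graph the semigroup preserves the mass of a non-negative function
in `L¹ ∩ L²`; for a superharmonic function this is compatible with the decay of
`iterate_resolvent_deficit` only if the function is harmonic. -/
theorem IsStochasticallyComplete.tsum_eq_zero {G : WeightedGraph X}
    (hsc : G.IsStochasticallyComplete) {v : G.L2} (hv : G.IsSuperharmonic v)
    (hv0 : ∀ x, 0 ≤ v x) (hv1 : Summable fun x => G.m x * v x) (a : X) :
    ∑' y, G.μ a y * (v a - v y) = 0 := by
  classical
  by_contra hne
  have hη : 0 < ∑' y, G.μ a y * (v a - v y) := (hv.tsum_nonneg a).lt_of_ne' hne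
  obtain ⟨δ, hδ, hdef⟩ : ∃ δ : ℝ, 0 < δ ∧ ∀ n : ℕ,
      δ ≤ v a - (G.resolvent (1 / (n + 1)))^[n + 1] v a := by
    refine ⟨(∑' y, G.μ a y * (v a - v y)) / (G.m a + ∑' y, G.μ a y), div_pos hη
      (add_pos_of_pos_of_nonneg (G.m_pos a) (tsum_nonneg (G.μ_nonneg a))), fun n => ?_⟩
    have h := G.iterate_resolvent_deficit hv hv0 (s := 1 / ((n : ℝ) + 1)) (by positivity) a (n + 1)
    rwa [Nat.cast_succ, mul_one_div_cancel (by positivity), one_mul, one_mul] at h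
  let ind : Finset X → G.L2 := fun K => G.ofFinsupp (∑ y ∈ K, Finsupp.single y 1)
  have hind : ∀ K x, ind K x = if x ∈ K then 1 else 0 := fun K x => by
    rw [coe_ofFinsupp, Finsupp.finsetSum_apply]
    simp [Finsupp.single_apply]
  have hind_inner : ∀ K (f : G.L2), inner ℝ (ind K) f = ∑ x ∈ K, G.m x * f x := fun K f => by
    refine (G.hasSum_inner _ _).unique ?_
    have h := hasSum_sum_of_ne_finset_zero (L := .unconditional X)
      (f := fun x => G.m x * (ind K x * f x)) (s := K)
      fun x hx => by rw [hind, if_neg hx, zero_mul, mul_zero]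
    rwa [Finset.sum_congr rfl fun x hx => by rw [hind, if_pos hx, one_mul]] at h
  have hbound : ∀ K x, G.heatSemigroup 1 (ind K) x ∈ Set.Icc (0 : ℝ) 1 := fun K =>
    G.heatSemigroup_mem_Icc one_pos (fun x => by rw [hind]; split_ifs <;> norm_num)
      (fun x => by rw [hind]; split_ifs <;> norm_num)
  have hupper : ∀ K : Finset X, a ∈ K →
      inner ℝ (G.heatSemigroup 1 (ind K)) v ≤ ∑ x ∈ K, G.m x * v x - G.m a * δ := by
    intro K ha
    refine le_of_tendsto ((G.tendsto_heatSemigroup one_pos (ind K)).inner tendsto_const_nhds)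
      (Eventually.of_forall fun n => ?_)
    rw [inner_iterate_resolvent_left, hind_inner, ← Finset.add_sum_erase K _ ha,
      ← Finset.add_sum_erase K (fun x => G.m x * v x) ha]
    have h1 : ∑ x ∈ K.erase a, G.m x * (G.resolvent (1 / (n + 1)))^[n + 1] v x
        ≤ ∑ x ∈ K.erase a, G.m x * v x :=
      Finset.sum_le_sum fun x _ => mul_le_mul_of_nonneg_left
        (G.iterate_resolvent_le hv hv0 _ _ (fun _ => le_rfl) x) (G.m_pos x).le
    have h2 := mul_le_mul_of_nonneg_left (hdef n) (G.m_pos a).le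
    linarith
  have hlim : Tendsto (fun K => inner ℝ (G.heatSemigroup 1 (ind K)) v) atTop
      (𝓝 (∑' x, G.m x * v x)) := by
    have h := tendsto_tsum_of_dominated_convergence hv1 (𝓕 := (atTop : Filter (Finset X)))
      (f := fun K x => G.m x * (G.heatSemigroup 1 (ind K) x * v x))
      (g := fun x => G.m x * (1 * v x))
      (fun x => ((hsc 1 zero_le_one x).mul_const _).const_mul _)
      (Eventually.of_forall fun K x => by
        have h01 := hbound K x
        rw [Real.norm_of_nonneg (mul_nonneg (G.m_pos x).le (mul_nonneg h01.1 (hv0 x)))]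
        exact mul_le_mul_of_nonneg_left (mul_le_of_le_one_left (hv0 x) h01.2) (G.m_pos x).le)
    simp only [one_mul] at h
    exact h.congr fun K => (G.hasSum_inner _ _).tsum_eq
  have hle := le_of_tendsto_of_tendsto hlim (hv1.hasSum.sub_const (G.m a * δ))
    ((eventually_ge_atTop {a}).mono fun K hK => hupper K (Finset.singleton_subset_iff.mp hK))
  have := mul_pos (G.m_pos a) hδ
  linarith

variable {G} in
theorem IsStochasticallyComplete.le_of_adj (hsc : G.IsStochasticallyComplete) {u : X → ℝ}
    (hnn : ∀ x, 0 ≤ u x) (hsup : G.IsSuperharmonic u) (hu : MemLp u 1 G.measure) {x y : X}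
    (hxy : G.Adj x y) : u x ≤ u y := by
  by_contra! hlt
  -- the truncation at the level `u x` attains its maximum at `x` and is smaller at `y`
  have hv := hsup.min_const (u x)
  have hv0 : ∀ z, 0 ≤ min (u z) (u x) := fun z => le_min (hnn z) (hnn x)
  have hmem : MemLp (fun z => min (u z) (u x)) 1 G.measure :=
    hu.mono (hu.1.inf aestronglyMeasurable_const) (Eventually.of_forall fun z => by
      rw [Real.norm_of_nonneg (hv0 z), Real.norm_of_nonneg (hnn z)]
      exact min_le_left _ _)
  have hmem2 := G.memLp_two_of_bounded hmem (c := u x) fun z => by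
    rw [abs_of_nonneg (hv0 z)]
    exact min_le_right _ _
  have e : (hmem2.toLp _ : X → ℝ) = fun z => min (u z) (u x) :=
    funext (G.ae_iff_forall.mp hmem2.coeFn_toLp)
  have h0 := hsc.tsum_eq_zero (v := hmem2.toLp _) (by rwa [e]) (by rwa [e]) (by
    rw [e]
    exact (G.summable_of_memLp_one hmem).congr fun z => by rw [abs_of_nonneg (hv0 z)]) x
  rw [e] at h0
  have hpos := (hv.summable x).tsum_pos (fun z => by
    rw [min_self]
    exact mul_nonneg (G.μ_nonneg x z) (sub_nonneg.mpr (min_le_right _ _))) y (by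
    rw [min_self, min_eq_left hlt.le]
    exact mul_pos hxy (sub_pos.mpr hlt))
  exact hpos.ne' h0

end WeightedGraph

theorem theorem1p5 {X : Type*} [Countable X] [MeasurableSpace X] [DiscreteMeasurableSpace X]
    (G : WeightedGraph X) (hconn : G.IsConnected) (hsc : G.IsStochasticallyComplete)
    (u : X → ℝ) (hnn : ∀ x, 0 ≤ u x) (hsup : G.IsSuperharmonic u) (hu : MemLp u 1 G.measure) :
    ∃ c : ℝ, ∀ x, u x = c := by
  have hle : ∀ x y, u x ≤ u y := fun x y => by
    induction hconn x y with
    | refl => exact le_rfl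
    | tail _ hadj ih => exact ih.trans (hsc.le_of_adj hnn hsup hu hadj)
  rcases isEmpty_or_nonempty X with hX | ⟨⟨a⟩⟩
  · exact ⟨0, fun x => isEmptyElim x⟩
  · exact ⟨u a, fun x => le_antisymm (hle x a) (hle a x)⟩
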